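/- Write points of the plane $\mathbb R^2$ as $(t,x)$, and for $U\subseteq\mathbb R^2$ put $U_t:=\{x\in\mathbb R\mid (t,x)\in U\}$. A set $U\subseteq\mathbb R^2$ is called $x$-simple if for every $t\in\mathbb R$ the set $U_t$ is an open (possibly unbounded) interval or empty. An $x$-simple piece of $U$ is a connected component of $U\cap(I\times\mathbb R)$, for some open interval $I\subseteq\mathbb R$, that is an $x$-simple set. Let $\Omega\subseteq\mathbb R^2$ be a nonempty open set. For $p\in\mathbb N=\{1,2,\dots\}$ and a continuous matrix function $A\in \mathrm C(\Omega,\mathrm M_p(\mathbb R))$, a solution on $\Omega$ of the system $v_x=Av$ is a continuous function $v\colon\Omega\to\mathbb R^p$ whose partial derivative $v_x$ exists and is continuous on $\Omega$ and which satisfies $v_x(t,x)=A(t,x)v(t,x)$ for all $(t,x)\in\Omega$. Then $\Omega$ contains no $x$-simple pieces if and only if for each $p\in\mathbb N$ there exists an infinite-parameter family of systems $v_x=Av$ with $A\in\mathrm C(\Omega,\mathrm M_p(\mathbb R))$ each of which possesses only the zero solution on $\Omega$. Here an infinite-parameter family means a family $(A_c)_{c\in\mathbb R^{\mathbb N}}$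 such that the map $c\mapsto A_c$ from $\mathbb R^{\mathbb N}$ (with the product topology) to $\mathrm C(\Omega,\mathrm M_p(\mathbb R))$ (with the topology of locally uniform convergence) is continuous and injective. -/

import Mathlib

/-- The section `U_t = {x | (t, x) ∈ U}` of a subset of the `(t, x)`-plane. -/
def xSection (U : Set (ℝ × ℝ)) (t : ℝ) : Set ℝ := {x | (t, x) ∈ U}

/-- A subset of the `(t, x)`-plane is `x`-simple if each of its sections by a line `t = const`
is an open (bounded or unbounded) interval or empty. -/
def IsXSimple (U : Set (ℝ × ℝ)) : Prop :=
  ∀ t : ℝ, IsOpen (xSection U t) ∧ (xSection U t).OrdConnected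

/-- `V` is an `x`-simple piece of `U`: for some open interval `I` of the `t`-axis, `V` is a
connected component of `U ∩ (I × ℝ)`, and `V` is `x`-simple. Components are nonempty, being the
components of points. -/
def IsXSimplePiece (U V : Set (ℝ × ℝ)) : Prop :=
  ∃ I : Set ℝ, IsOpen I ∧ I.OrdConnected ∧
    (∃ z ∈ U ∩ I ×ˢ Set.univ, V = connectedComponentIn (U ∩ I ×ˢ Set.univ) z) ∧ IsXSimple V

/-- The partial derivative with respect to `x` of a vector function of `(t, x)`. -/
noncomputable def xDeriv {p : ℕ} (v : ℝ × ℝ → Fin p → ℝ) (z : ℝ × ℝ) : Fin p → ℝ :=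
  deriv (fun x : ℝ => v (z.1, x)) z.2

/-- The class `C¹_x(Ω, ℝᵖ)`: continuous on `Ω`, with a derivative in `x` that exists and is
(jointly) continuous on `Ω`. Values outside the open set `Ω` are irrelevant. -/
def MemC1x {p : ℕ} (Ω : Set (ℝ × ℝ)) (v : ℝ × ℝ → Fin p → ℝ) : Prop :=
  ContinuousOn v Ω ∧
    (∀ z ∈ Ω, DifferentiableAt ℝ (fun x : ℝ => v (z.1, x)) z.2) ∧
    ContinuousOn (xDeriv v) Ω

/-- `v` is a classical solution on `Ω` of the system `v_x = A v`. -/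
def IsSystemSolution {p : ℕ} (Ω : Set (ℝ × ℝ)) (A : C(Ω, Matrix (Fin p) (Fin p) ℝ))
    (v : ℝ × ℝ → Fin p → ℝ) : Prop :=
  MemC1x Ω v ∧ ∀ z : Ω, xDeriv v z = (A z).mulVec (v z)

/-- The system `v_x = A v` possesses only the zero solution on `Ω`. -/
def HasOnlyZeroSolution {p : ℕ} (Ω : Set (ℝ × ℝ)) (A : C(Ω, Matrix (Fin p) (Fin p) ℝ)) : Prop :=
  ∀ v : ℝ × ℝ → Fin p → ℝ, IsSystemSolution Ω A v → ∀ z ∈ Ω, v z = 0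

/-- A family of elements of a topological space that depends continuously on infinitely many
independent real parameters `c 0, c 1, c 2, …`, all of which are essential: different parameter
sequences give different elements. -/
def IsInfiniteParameterFamily {X : Type*} [TopologicalSpace X] (F : (ℕ → ℝ) → X) : Prop :=
  Continuous F ∧ Function.Injective F

/-!
For a given level `r`, let `Ω_r` be the set of points of `Ω` joined to the line `x = r` by a segment
in the `x`-direction inside `Ω`. There a solution of `v_x = a v` is
`v (t, x) = exp (∫ s in r..x, a (t, s)) • v (t, r)`.

Suppose that `I × {r} ⊆ Ω` for a nonempty open interval `I`. The part of `Ω_r` over `I` is open,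
connected and `x`-simple, so if `Ω` has no `x`-simple piece, it is not relatively closed in
`Ω ∩ (I × ℝ)`: some `z ∈ Ω` over `I` is a boundary point of `Ω_r`. The segment from `z` to the line
`x = r` leaves `Ω`, so segments from nearby points of `Ω_r` leave any given compact subset of `Ω`,
and `a` can be changed off that compact set to make the primitive large near `z`. By Baire's
theorem a generic `a` has a primitive that is unbounded above near all such `z`, for all rational
`r` at once. Continuity of a solution `v` at `z` then forces `v (z.1, r) = 0`; as `I` and `r` are
arbitrary, `v` vanishes on a dense subset of `Ω`, hence on `Ω`. Adding to `a` a function that is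
continuous on the whole plane does not affect the unboundedness, which yields the family.

Conversely, on an `x`-simple piece the function `φ t * exp (∫ s in x₀..x, a (t, s))`, with a bump
function `φ`, extends by zero to a nonzero solution on `Ω`, for every `a`.
-/

open Set Filter Topology

section XVisible

variable {T : Type*}

/-- The points of `Ω` that are joined inside `Ω`, by a segment in the `x`-direction, to the line
`x = r`. -/
def xVisible (Ω : Set (T × ℝ)) (r : ℝ) : Set (T × ℝ) :=
  {z | ∀ s ∈ uIcc r z.2, (z.1, s) ∈ Ω}

variable {Ω : Set (T × ℝ)} {r : ℝ} {z : T × ℝ}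

theorem xVisible_subset : xVisible Ω r ⊆ Ω := fun _ hz => hz _ right_mem_uIcc

theorem fst_mk_mem_xVisible (hz : z ∈ xVisible Ω r) {s : ℝ} (hs : s ∈ uIcc r z.2) :
    (z.1, s) ∈ xVisible Ω r :=
  fun _ hs' => hz _ (uIcc_subset_uIcc_left hs hs')

theorem mk_mem_xVisible {t : T} (ht : (t, r) ∈ Ω) : (t, r) ∈ xVisible Ω r := by
  simpa [xVisible] using ht

theorem mem_xVisible_iff_lineMap :
    z ∈ xVisible Ω r ↔ ∀ θ ∈ Icc (0 : ℝ) 1, (z.1, AffineMap.lineMap r z.2 θ) ∈ Ω := by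
  simp only [xVisible, mem_ofPred_eq, ← segment_eq_uIcc, segment_eq_image_lineMap, forall_mem_image]

theorem isOpen_xVisible [TopologicalSpace T] (hΩ : IsOpen Ω) (r : ℝ) : IsOpen (xVisible Ω r) := by
  rw [isOpen_iff_eventually]
  intro z hz
  simp only [mem_xVisible_iff_lineMap] at hz ⊢
  refine isCompact_Icc.eventually_forall_of_forall_eventually fun θ hθ => ?_
  have hcont : Continuous fun w : (T × ℝ) × ℝ => (w.1.1, AffineMap.lineMap r w.1.2 w.2) := by
    simp only [AffineMap.lineMap_apply]
    fun_prop
  exact hcont.continuousAt.eventually_mem (hΩ.mem_nhds (hz θ hθ))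

theorem ordConnected_preimage_mk_xVisible (Ω : Set (T × ℝ)) (r : ℝ) (t : T) :
    (Prod.mk t ⁻¹' xVisible Ω r).OrdConnected := by
  refine ⟨fun y hy y' hy' x hx s hs => ?_⟩
  have hs' : s ∈ uIcc r y ∪ uIcc r y' := by
    simp only [mem_union, mem_uIcc, mem_Icc] at hs hx ⊢
    grind
  exact hs'.elim (hy s) (hy' s)

theorem isPreconnected_xVisible_inter_prod [TopologicalSpace T] {I : Set T}
    (hI : IsPreconnected I) (hr : ∀ t ∈ I, (t, r) ∈ Ω) :
    IsPreconnected (xVisible Ω r ∩ I ×ˢ univ) := by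
  have hline : I ×ˢ {r} ⊆ xVisible Ω r ∩ I ×ˢ univ := by
    rintro ⟨t, _⟩ ⟨ht, rfl⟩
    exact ⟨mk_mem_xVisible (hr t ht), ht, trivial⟩
  refine isPreconnected_of_forall_pair fun z hz w hw => ?_
  have hsegment : ∀ z ∈ xVisible Ω r ∩ I ×ˢ univ,
      {z.1} ×ˢ uIcc r z.2 ⊆ xVisible Ω r ∩ I ×ˢ univ := by
    rintro z hz ⟨_, s⟩ ⟨rfl, hs⟩
    exact ⟨fst_mk_mem_xVisible hz.1 hs, hz.2.1, trivial⟩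
  have hcomb : ∀ z ∈ xVisible Ω r ∩ I ×ˢ univ,
      IsPreconnected (I ×ˢ {r} ∪ {z.1} ×ˢ uIcc r z.2) := fun z hz =>
    (hI.prod isPreconnected_singleton).union (z.1, r) ⟨hz.2.1, rfl⟩ ⟨rfl, left_mem_uIcc⟩
      (isPreconnected_singleton.prod isPreconnected_uIcc)
  exact ⟨_, union_subset (union_subset hline (hsegment z hz)) (union_subset hline (hsegment w hw)),
    Or.inl (Or.inr ⟨rfl, right_mem_uIcc⟩), Or.inr (Or.inr ⟨rfl, right_mem_uIcc⟩),
    (hcomb z hz).union (z.1, r) (Or.inl ⟨hz.2.1, rfl⟩) (Or.inl ⟨hz.2.1, rfl⟩) (hcomb w hw)⟩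

end XVisible

section XPrimitive

variable {T : Type*} [TopologicalSpace T] {Ω : Set (T × ℝ)} {r : ℝ}

/-- The primitive in `x` of a continuous function on `Ω` that vanishes on the line `x = r`. It is
meaningful on `xVisible Ω r`, where the extension of `a` by zero outside `Ω` is not seen. -/
noncomputable def xPrimitive (r : ℝ) (a : C(Ω, ℝ)) (z : T × ℝ) : ℝ :=
  ∫ s in r..z.2, Function.extend Subtype.val a 0 (z.1, s)

theorem extend_val_apply_of_mem (a : C(Ω, ℝ)) {z : T × ℝ} (hz : z ∈ Ω) :
    Function.extend Subtype.val a 0 z = a ⟨z, hz⟩ :=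
  Subtype.val_injective.extend_apply a 0 ⟨z, hz⟩

theorem continuousOn_extend_val (a : C(Ω, ℝ)) :
    ContinuousOn (Function.extend Subtype.val a 0) Ω := by
  rw [continuousOn_iff_continuous_domRestrict]
  exact a.continuous.congr fun z => (extend_val_apply_of_mem a z.2).symm

theorem intervalIntegrable_extend_val (a : C(Ω, ℝ)) {z : T × ℝ} (hz : z ∈ xVisible Ω r) :
    IntervalIntegrable (fun s => Function.extend Subtype.val a 0 (z.1, s))
      MeasureTheory.volume r z.2 :=
  ((continuousOn_extend_val a).comp (by fun_prop) hz).intervalIntegrable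

theorem xPrimitive_add (a b : C(Ω, ℝ)) {z : T × ℝ} (hz : z ∈ xVisible Ω r) :
    xPrimitive r (a + b) z = xPrimitive r a z + xPrimitive r b z := by
  simp only [xPrimitive]
  rw [← intervalIntegral.integral_add (intervalIntegrable_extend_val a hz)
    (intervalIntegrable_extend_val b hz)]
  refine intervalIntegral.integral_congr fun s hs => ?_
  simp only [extend_val_apply_of_mem _ (hz s hs), ContinuousMap.add_apply]

theorem xPrimitive_smul (c : ℝ) (a : C(Ω, ℝ)) {z : T × ℝ} (hz : z ∈ xVisible Ω r) :
    xPrimitive r (c • a) z = c * xPrimitive r a z := by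
  simp only [xPrimitive]
  rw [← intervalIntegral.integral_const_mul]
  refine intervalIntegral.integral_congr fun s hs => ?_
  simp only [extend_val_apply_of_mem _ (hz s hs), ContinuousMap.smul_apply, smul_eq_mul]

theorem xPrimitive_restrict (f : C(T × ℝ, ℝ)) {z : T × ℝ} (hz : z ∈ xVisible Ω r) :
    xPrimitive r (f.restrict Ω) z = ∫ s in r..z.2, f (z.1, s) :=
  intervalIntegral.integral_congr fun s hs => extend_val_apply_of_mem _ (hz s hs)

theorem continuous_xPrimitive [LocallyCompactSpace Ω] (r : ℝ) :
    Continuous fun q : C(Ω, ℝ) × xVisible Ω r => xPrimitive r q.1 q.2 := by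
  let γ : xVisible Ω r × ℝ → Ω := fun q =>
    ⟨(q.1.1.1, AffineMap.lineMap r q.1.1.2 (projIcc (0 : ℝ) 1 zero_le_one q.2 : ℝ)),
      mem_xVisible_iff_lineMap.1 q.1.2 _ (Subtype.coe_prop _)⟩
  have hγ : Continuous γ := by
    refine Continuous.subtype_mk ?_ _
    simp only [AffineMap.lineMap_apply]
    fun_prop
  have hcont : Continuous fun q : C(Ω, ℝ) × xVisible Ω r =>
      (q.2.1.2 - r) * ∫ θ in (0 : ℝ)..1, q.1 (γ (q.2, θ)) := by
    refine Continuous.mul (by fun_prop) ?_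
    apply intervalIntegral.continuous_parametric_intervalIntegral_of_continuous'
    unfold Function.uncurry
    fun_prop
  refine hcont.congr fun ⟨a, z⟩ => ?_
  have hreparam := intervalIntegral.smul_integral_comp_mul_add (a := 0) (b := 1)
    (fun s => Function.extend Subtype.val a 0 (z.1.1, s)) (z.1.2 - r) r
  simp only [mul_zero, zero_add, mul_one, sub_add_cancel, smul_eq_mul] at hreparam
  rw [xPrimitive, ← hreparam]
  congr 1
  refine intervalIntegral.integral_congr fun θ hθ => ?_
  rw [uIcc_of_le zero_le_one] at hθ
  have hγθ : (γ (z, θ) : T × ℝ) = (z.1.1, (z.1.2 - r) * θ + r) := by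
    simp only [γ, projIcc_of_mem zero_le_one hθ, AffineMap.lineMap_apply_ring', mul_comm]
  simp only [← hγθ, extend_val_apply_of_mem a (γ (z, θ)).2]

theorem continuous_xPrimitive_left [LocallyCompactSpace Ω] {z : T × ℝ} (hz : z ∈ xVisible Ω r) :
    Continuous fun a : C(Ω, ℝ) => xPrimitive r a z :=
  (continuous_xPrimitive r).comp (Continuous.prodMk_left ⟨z, hz⟩)

theorem isOpen_setOf_exists_lt_xPrimitive [LocallyCompactSpace Ω] (r : ℝ) (U : Set (T × ℝ))
    (N : ℝ) :
    IsOpen {a : C(Ω, ℝ) | ∃ w ∈ U ∩ xVisible Ω r, N < xPrimitive r a w} := by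
  have hunion : {a : C(Ω, ℝ) | ∃ w ∈ U ∩ xVisible Ω r, N < xPrimitive r a w} =
      ⋃ w ∈ U ∩ xVisible Ω r, {a | N < xPrimitive r a w} := by
    ext a
    simp
  rw [hunion]
  exact isOpen_biUnion fun w hw => isOpen_lt continuous_const (continuous_xPrimitive_left hw.2)

theorem continuousOn_xPrimitive [LocallyCompactSpace Ω] (a : C(Ω, ℝ)) :
    ContinuousOn (xPrimitive r a) (xVisible Ω r) :=
  continuousOn_iff_continuous_domRestrict.2
    ((continuous_xPrimitive r).comp (Continuous.prodMk_right a))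

theorem hasDerivAt_xPrimitive (hΩ : IsOpen Ω) (a : C(Ω, ℝ)) {z : T × ℝ}
    (hz : z ∈ xVisible Ω r) :
    HasDerivAt (fun x => xPrimitive r a (z.1, x)) (a ⟨z, xVisible_subset hz⟩) z.2 := by
  have hcont : ContinuousOn (fun s => Function.extend Subtype.val a 0 (z.1, s))
      (Prod.mk z.1 ⁻¹' Ω) :=
    (continuousOn_extend_val a).comp (by fun_prop) (mapsTo_preimage _ _)
  have hopen : IsOpen (Prod.mk z.1 ⁻¹' Ω) := hΩ.preimage (Continuous.prodMk_right z.1)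
  have hmem : z.2 ∈ Prod.mk z.1 ⁻¹' Ω := xVisible_subset hz
  rw [← extend_val_apply_of_mem]
  exact intervalIntegral.integral_hasDerivAt_right (intervalIntegrable_extend_val a hz)
    (hcont.stronglyMeasurableAtFilter hopen _ hmem) (hcont.continuousAt (hopen.mem_nhds hmem))

end XPrimitive

section ScalarSolution

variable {T : Type*} [TopologicalSpace T] {Ω : Set (T × ℝ)} {r : ℝ}
  {E : Type*} [NormedAddCommGroup E] [NormedSpace ℝ E]

/-- At the point `z` of `Ω`, the vector function `v` is continuous and satisfies the equation
`v_x = a v` with scalar coefficient `a`. For open `Ω`, the solutions on `Ω` are the functions that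
satisfy this at each `z : Ω`: continuity of `v_x` follows from that of `a` and `v`. -/
structure IsScalarSolutionAt (a : C(Ω, ℝ)) (v : T × ℝ → E) (z : Ω) : Prop where
  continuousAt : ContinuousAt v z
  hasDerivAt : HasDerivAt (fun x => v (z.1.1, x)) (a z • v z) z.1.2

theorem IsScalarSolutionAt.congr_of_eventuallyEq {a : C(Ω, ℝ)} {v w : T × ℝ → E} {z : Ω}
    (hv : IsScalarSolutionAt a v z) (h : w =ᶠ[𝓝 (z : T × ℝ)] v) : IsScalarSolutionAt a w z where
  continuousAt := hv.continuousAt.congr h.symm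
  hasDerivAt := h.self_of_nhds ▸ hv.hasDerivAt.congr_of_eventuallyEq
    ((Continuous.prodMk_right z.1.1).continuousAt.eventually h)

theorem isScalarSolutionAt_zero (a : C(Ω, ℝ)) (z : Ω) :
    IsScalarSolutionAt a (0 : T × ℝ → E) z where
  continuousAt := continuousAt_const
  hasDerivAt := by simpa using hasDerivAt_const z.1.2 (0 : E)

theorem isScalarSolutionAt_exp_xPrimitive [LocallyCompactSpace Ω] (hΩ : IsOpen Ω) (a : C(Ω, ℝ))
    {φ : T → ℝ} (hφ : Continuous φ) (e : E) {z : Ω} (hz : (z : T × ℝ) ∈ xVisible Ω r) :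
    IsScalarSolutionAt a (fun w => (φ w.1 * Real.exp (xPrimitive r a w)) • e) z where
  continuousAt := by
    have hP := (continuousOn_xPrimitive a).continuousAt ((isOpen_xVisible hΩ r).mem_nhds hz)
    exact ((hφ.comp continuous_fst).continuousAt.mul hP.rexp).smul continuousAt_const
  hasDerivAt := by
    refine (((hasDerivAt_xPrimitive hΩ a hz).exp.const_mul (φ z.1.1)).smul_const e).congr_deriv ?_
    rw [smul_smul]
    ring_nf

theorem eq_exp_sub_smul_of_hasDerivAt {P b : ℝ → ℝ} {u : ℝ → E} {x y : ℝ}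
    (hP : ∀ s ∈ uIcc x y, HasDerivAt P (b s) s)
    (hu : ∀ s ∈ uIcc x y, HasDerivAt u (b s • u s) s) :
    u y = Real.exp (P y - P x) • u x := by
  have hconst : ∀ s ∈ uIcc x y,
      HasDerivWithinAt (fun s => Real.exp (-P s) • u s) 0 (uIcc x y) s := fun s hs => by
    refine (((hP s hs).neg.exp.smul (hu s hs)).congr_deriv ?_).hasDerivWithinAt
    simp only [Pi.neg_apply]
    module
  have heq : Real.exp (-P y) • u y = Real.exp (-P x) • u x := by
    simpa [sub_eq_zero] using (convex_uIcc x y).norm_image_sub_le_of_norm_hasDerivWithin_le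
      (C := 0) hconst (by simp) left_mem_uIcc right_mem_uIcc
  rw [sub_eq_add_neg, Real.exp_add, mul_smul, ← heq, smul_smul, ← Real.exp_add]
  simp

theorem eq_exp_xPrimitive_smul (hΩ : IsOpen Ω) {a : C(Ω, ℝ)} {v : T × ℝ → E}
    (hv : ∀ z, IsScalarSolutionAt a v z) {z : T × ℝ} (hz : z ∈ xVisible Ω r) :
    v z = Real.exp (xPrimitive r a z) • v (z.1, r) := by
  have h := eq_exp_sub_smul_of_hasDerivAt (x := r) (y := z.2)
    (P := fun s => xPrimitive r a (z.1, s)) (u := fun s => v (z.1, s))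
    (b := fun s => Function.extend Subtype.val a 0 (z.1, s))
    (fun s hs => by
      simpa only [extend_val_apply_of_mem a (hz s hs)] using
        hasDerivAt_xPrimitive hΩ a (fst_mk_mem_xVisible hz hs))
    (fun s hs => by
      simpa only [extend_val_apply_of_mem a (hz s hs)] using (hv ⟨_, hz s hs⟩).hasDerivAt)
  simpa [xPrimitive] using h

theorem eq_zero_of_frequently_lt_xPrimitive (hΩ : IsOpen Ω) {a : C(Ω, ℝ)} {v : T × ℝ → E}
    (hv : ∀ z, IsScalarSolutionAt a v z) {z : T × ℝ} (hz : z ∈ Ω) (hr : (z.1, r) ∈ Ω)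
    (hunbdd : ∀ N : ℝ, ∃ᶠ w in 𝓝[xVisible Ω r] z, N < xPrimitive r a w) : v (z.1, r) = 0 := by
  -- Along `l`, `v (t, r) = exp (-∫ a) • v (t, y)` with bounded second factor and `∫ a → ∞`.
  -- Along `l`, `v (t, r) = exp (-∫ a) • v (t, y)` with bounded second factor and `∫ a → ∞`.
  let l : Filter (T × ℝ) := 𝓝[xVisible Ω r] z ⊓ comap (xPrimitive r a) atTop
  have hl : l.NeBot := inf_neBot_iff_frequently_right.2 fun {p} hp => by
    obtain ⟨N, -, hN⟩ := ((atTop_basis_Ioi' (0 : ℝ)).comap _).eventually_iff.1 hp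
    exact (hunbdd N).mono fun w hw => hN hw
  have hlz : l ≤ 𝓝 z := inf_le_left.trans nhdsWithin_le_nhds
  have hP : Tendsto (xPrimitive r a) l atTop := tendsto_comap.mono_left inf_le_right
  have hvz : Tendsto v l (𝓝 (v z)) := (hv ⟨z, hz⟩).continuousAt.mono_left hlz
  have hvr : Tendsto (fun w => v (w.1, r)) l (𝓝 (v (z.1, r))) :=
    (hv ⟨_, hr⟩).continuousAt.tendsto.comp
      ((Continuous.prodMk_left r).comp continuous_fst |>.continuousAt.mono_left hlz)
  have hvr' : Tendsto (fun w => v (w.1, r)) l (𝓝 ((0 : ℝ) • v z)) := by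
    refine ((Real.tendsto_exp_neg_atTop_nhds_zero.comp hP).smul hvz).congr' ?_
    have hvis : ∀ᶠ w in l, w ∈ xVisible Ω r := mem_inf_of_left self_mem_nhdsWithin
    filter_upwards [hvis] with w hw
    rw [eq_exp_xPrimitive_smul hΩ hv hw, smul_smul, Function.comp_apply, ← Real.exp_add]
    simp
  simpa using tendsto_nhds_unique hvr hvr'

theorem frequently_lt_xPrimitive_add_restrict {a : C(Ω, ℝ)} {z : T × ℝ}
    (hunbdd : ∀ N : ℝ, ∃ᶠ w in 𝓝[xVisible Ω r] z, N < xPrimitive r a w) (f : C(T × ℝ, ℝ)) (N : ℝ) :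
    ∃ᶠ w in 𝓝[xVisible Ω r] z, N < xPrimitive r (a + f.restrict Ω) w := by
  have hcont : Continuous fun w : T × ℝ => ∫ s in r..w.2, f (w.1, s) :=
    intervalIntegral.continuous_parametric_intervalIntegral_of_continuous
      (f := fun (w : T × ℝ) s => f (w.1, s)) (by unfold Function.uncurry; fun_prop) continuous_snd
  set L := ∫ s in r..z.2, f (z.1, s)
  have hbdd : ∀ᶠ w in 𝓝[xVisible Ω r] z, L - 1 < ∫ s in r..w.2, f (w.1, s) :=
    nhdsWithin_le_nhds (hcont.continuousAt.eventually_const_lt (sub_one_lt L))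
  refine ((hunbdd (N - (L - 1))).and_eventually (hbdd.and self_mem_nhdsWithin)).mono ?_
  rintro w ⟨hN, hL, hw⟩
  rw [xPrimitive_add _ _ hw, xPrimitive_restrict _ hw]
  linarith

end ScalarSolution

section Genericity

theorem dense_of_forall_exists_eqOn_isCompact {X Y : Type*} [TopologicalSpace X]
    [TopologicalSpace Y] {S : Set C(X, Y)}
    (h : ∀ (f : C(X, Y)) (K : Set X), IsCompact K → ∃ g ∈ S, EqOn g f K) : Dense S := by
  intro f
  rw [mem_closure_iff_nhds_basis f.hasBasis_nhds]
  rintro F ⟨hF, hFf⟩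
  obtain ⟨g, hgS, hg⟩ := h f (⋃ KU ∈ F, KU.1)
    (hF.isCompact_biUnion fun KU hKU => (hFf KU.1 KU.2 hKU).1)
  refine ⟨g, hgS, mem_iInter₂.2 fun KU hKU x hx => ?_⟩
  rw [hg (mem_biUnion hKU hx)]
  exact (hFf KU.1 KU.2 hKU).2.2 hx

theorem intervalIntegral_ne_zero_of_nonneg {f : ℝ → ℝ} {x y : ℝ}
    (hf : ContinuousOn f (uIcc x y)) (hf₀ : ∀ s ∈ uIcc x y, 0 ≤ f s) (hxy : x ≠ y)
    (hpos : ∃ m ∈ uIcc x y, 0 < f m) : ∫ s in x..y, f s ≠ 0 := by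
  rcases hxy.lt_or_gt with h | h
  · rw [uIcc_of_lt h] at hf hf₀ hpos
    exact (intervalIntegral.integral_pos h hf (fun s hs => hf₀ s (Ioc_subset_Icc_self hs)) hpos).ne'
  · rw [uIcc_of_gt h] at hf hf₀ hpos
    rw [intervalIntegral.integral_symm, neg_ne_zero]
    exact (intervalIntegral.integral_pos h hf (fun s hs => hf₀ s (Ioc_subset_Icc_self hs)) hpos).ne'

variable {T : Type*} [TopologicalSpace T] [T2Space T] {Ω : Set (T × ℝ)} {r : ℝ}

theorem exists_xVisible_not_subset_of_mem_frontier (hΩ : IsOpen Ω) {z : T × ℝ}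
    (hz : z ∈ Ω ∩ frontier (xVisible Ω r)) {U K : Set (T × ℝ)} (hU : U ∈ 𝓝 z) (hK : IsCompact K)
    (hKΩ : K ⊆ Ω) :
    ∃ w ∈ U ∩ xVisible Ω r, r ≠ w.2 ∧ ∃ m ∈ uIcc r w.2, (w.1, m) ∉ K := by
  obtain ⟨hzΩ, hfr⟩ := hz
  rw [(isOpen_xVisible hΩ r).frontier_eq] at hfr
  have hzr : r ≠ z.2 := by
    rintro rfl
    exact hfr.2 (mk_mem_xVisible hzΩ)
  obtain ⟨θ, hθ, hθΩ⟩ : ∃ θ ∈ Icc (0 : ℝ) 1, (z.1, AffineMap.lineMap r z.2 θ) ∉ Ω := by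
    simpa only [mem_xVisible_iff_lineMap, not_forall, exists_prop] using hfr.2
  have hcont : Continuous fun w : T × ℝ => (w.1, AffineMap.lineMap r w.2 θ) := by
    simp only [AffineMap.lineMap_apply]
    fun_prop
  have hK' : ∀ᶠ w in 𝓝 z, (w.1, AffineMap.lineMap r w.2 θ) ∉ K :=
    hcont.continuousAt.eventually_mem (hK.isClosed.isOpen_compl.mem_nhds fun h => hθΩ (hKΩ h))
  have hr : ∀ᶠ w in 𝓝 z, r ≠ w.2 := continuous_snd.continuousAt.eventually_ne hzr.symm |>.mono
    fun _ h => h.symm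
  obtain ⟨w, hw, hwU, hwr, hwK⟩ := ((mem_closure_iff_frequently.1 hfr.1).and_eventually
    ((eventually_mem_set.2 hU).and (hr.and hK'))).exists
  refine ⟨w, ⟨hwU, hw⟩, hwr, _, ?_, hwK⟩
  rw [← segment_eq_uIcc, segment_eq_image_lineMap]
  exact mem_image_of_mem _ hθ

variable [LocallyCompactSpace T]

theorem exists_xPrimitive_restrict_ne_zero {K : Set (T × ℝ)} (hK : IsCompact K) {w : T × ℝ}
    (hw : w ∈ xVisible Ω r) (hwr : r ≠ w.2) (hwK : ∃ m ∈ uIcc r w.2, (w.1, m) ∉ K) :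
    ∃ ψ : C(T × ℝ, ℝ), EqOn ψ 0 K ∧ xPrimitive r (ψ.restrict Ω) w ≠ 0 := by
  obtain ⟨m, hm, hmK⟩ := hwK
  obtain ⟨ψ, hψK, hψm, hψ⟩ := exists_continuous_zero_one_of_isCompact hK isClosed_singleton
    (disjoint_singleton_right.2 hmK)
  refine ⟨ψ, hψK, ?_⟩
  rw [xPrimitive_restrict ψ hw]
  refine intervalIntegral_ne_zero_of_nonneg (by fun_prop) (fun s _ => (hψ _).1) hwr ⟨m, hm, ?_⟩
  rw [hψm rfl]
  exact one_pos

theorem dense_setOf_exists_lt_xPrimitive (hΩ : IsOpen Ω) {z : T × ℝ}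
    (hz : z ∈ Ω ∩ frontier (xVisible Ω r)) {U : Set (T × ℝ)} (hU : U ∈ 𝓝 z) (N : ℝ) :
    Dense {a : C(Ω, ℝ) | ∃ w ∈ U ∩ xVisible Ω r, N < xPrimitive r a w} := by
  refine dense_of_forall_exists_eqOn_isCompact fun a K hK => ?_
  have hK' : IsCompact (Subtype.val '' K) := hK.image continuous_subtype_val
  obtain ⟨w, hw, hwr, hwK⟩ :=
    exists_xVisible_not_subset_of_mem_frontier hΩ hz hU hK' (Subtype.coe_image_subset Ω K)
  obtain ⟨ψ, hψK, hψw⟩ := exists_xPrimitive_restrict_ne_zero hK' hw.2 hwr hwK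
  -- Adding a multiple of `ψ` moves the primitive at `w` to `N + 1` without changing `a` on `K`.
  -- Adding a multiple of `ψ` moves the primitive at `w` to `N + 1` without changing `a` on `K`.
  let M : ℝ := (N + 1 - xPrimitive r a w) / xPrimitive r (ψ.restrict Ω) w
  refine ⟨a + M • ψ.restrict Ω, ⟨w, hw, ?_⟩, fun x hx => ?_⟩
  · rw [xPrimitive_add _ _ hw.2, xPrimitive_smul _ _ hw.2, div_mul_cancel₀ _ hψw]
    linarith
  · simp [hψK (mem_image_of_mem _ hx)]

theorem exists_forall_frequently_lt_xPrimitive [SecondCountableTopology T] (hΩ : IsOpen Ω)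
    {R : Set ℝ} (hR : R.Countable) :
    ∃ a : C(Ω, ℝ), ∀ r ∈ R, ∀ z ∈ Ω ∩ frontier (xVisible Ω r), ∀ N : ℝ,
      ∃ᶠ w in 𝓝[xVisible Ω r] z, N < xPrimitive r a w := by
  have : LocallyCompactSpace Ω := hΩ.locallyCompactSpace
  let B := TopologicalSpace.countableBasis (T × ℝ)
  have hB : TopologicalSpace.IsTopologicalBasis B := TopologicalSpace.isBasis_countableBasis _
  let ι := {i : R × B × ℕ // (i.2.1.1 ∩ (Ω ∩ frontier (xVisible Ω i.1.1))).Nonempty}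
  have : Countable R := hR
  have : Countable B := TopologicalSpace.countable_countableBasis _
  obtain ⟨a, ha⟩ := (dense_iInter_of_isOpen (ι := ι)
    (f := fun i => {a : C(Ω, ℝ) | ∃ w ∈ i.1.2.1.1 ∩ xVisible Ω i.1.1,
      (i.1.2.2 : ℝ) < xPrimitive i.1.1 a w})
    (fun i => isOpen_setOf_exists_lt_xPrimitive _ _ _)
    (fun ⟨⟨_, U, _⟩, _, hzU, hz⟩ => dense_setOf_exists_lt_xPrimitive hΩ hz
      ((hB.isOpen U.2).mem_nhds hzU) _)).nonempty
  refine ⟨a, fun r hr z hz N => ?_⟩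
  rw [(nhdsWithin_hasBasis hB.nhds_hasBasis _).frequently_iff]
  rintro U ⟨hUB, hzU⟩
  obtain ⟨n, hn⟩ := exists_nat_gt N
  obtain ⟨w, hw, hlt⟩ := mem_iInter.1 ha ⟨(⟨r, hr⟩, ⟨U, hUB⟩, n), z, hzU, hz⟩
  exact ⟨w, hw, hn.trans hlt⟩

end Genericity

section XSimplePiece

theorem connectedComponentIn_eq_of_isOpen {X : Type*} [TopologicalSpace X] {S W : Set X} {z : X}
    (hS : IsOpen S) (hconn : IsPreconnected S) (hSW : S ⊆ W) (hclosed : closure S ∩ W ⊆ S)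
    (hz : z ∈ S) : connectedComponentIn W z = S := by
  refine Subset.antisymm ?_ (hconn.subset_connectedComponentIn hz hSW)
  refine isPreconnected_connectedComponentIn.subset_of_closure_inter_subset hS
    ⟨z, mem_connectedComponentIn (hSW hz), hz⟩ ?_
  exact (inter_subset_inter_right _ (connectedComponentIn_subset W z)).trans hclosed

theorem eventually_notMem_connectedComponentIn {X : Type*} [TopologicalSpace X]
    [LocallyConnectedSpace X] {W : Set X} (hW : IsOpen W) {z₀ z : X} (hz : z ∈ W)
    (hz₀ : z ∉ connectedComponentIn W z₀) : ∀ᶠ w in 𝓝 z, w ∉ connectedComponentIn W z₀ := by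
  have hz' : z ∈ connectedComponentIn W z := mem_connectedComponentIn hz
  filter_upwards [hW.connectedComponentIn.mem_nhds hz'] with w hw hw₀
  rw [connectedComponentIn_eq hw₀, ← connectedComponentIn_eq hw] at hz₀
  exact hz₀ hz'

variable {Ω : Set (ℝ × ℝ)}

theorem isXSimplePiece_xVisible_inter_prod (hΩ : IsOpen Ω) {I : Set ℝ} (hI : IsOpen I)
    (hIord : I.OrdConnected) (hIne : I.Nonempty) {r : ℝ} (hr : ∀ t ∈ I, (t, r) ∈ Ω)
    (hfr : ∀ z ∈ Ω ∩ frontier (xVisible Ω r), z.1 ∉ I) :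
    IsXSimplePiece Ω (xVisible Ω r ∩ I ×ˢ univ) := by
  have hopen := isOpen_xVisible hΩ r
  have hopenI : IsOpen (xVisible Ω r ∩ I ×ˢ univ) := hopen.inter (hI.prod isOpen_univ)
  obtain ⟨t, ht⟩ := hIne
  refine ⟨I, hI, hIord, ⟨(t, r), ⟨hr t ht, ht, trivial⟩, ?_⟩, fun t => ⟨?_, ?_⟩⟩
  · refine (connectedComponentIn_eq_of_isOpen hopenI
      (isPreconnected_xVisible_inter_prod hIord.isPreconnected hr)
      (inter_subset_inter_left _ xVisible_subset) ?_ ⟨mk_mem_xVisible (hr t ht), ht, trivial⟩).symm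
    rintro z ⟨hzcl, hzΩ, hzI⟩
    refine ⟨by_contra fun hzvis => hfr z ⟨hzΩ, ?_⟩ hzI.1, hzI⟩
    rw [hopen.frontier_eq]
    exact ⟨closure_mono inter_subset_left hzcl, hzvis⟩
  · exact hopenI.preimage (Continuous.prodMk_right t)
  · exact ⟨fun _ hy _ hy' _ hx =>
      ⟨(ordConnected_preimage_mk_xVisible Ω r t).out hy.1 hy'.1 hx, hy.2⟩⟩

theorem exists_mem_frontier_xVisible (hΩ : IsOpen Ω) (hno : ¬ ∃ V, IsXSimplePiece Ω V) {I : Set ℝ}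
    (hI : IsOpen I) (hIord : I.OrdConnected) (hIne : I.Nonempty) {r : ℝ}
    (hr : ∀ t ∈ I, (t, r) ∈ Ω) : ∃ z ∈ Ω ∩ frontier (xVisible Ω r), z.1 ∈ I := by
  by_contra! hfr
  exact hno ⟨_, isXSimplePiece_xVisible_inter_prod hΩ hI hIord hIne hr hfr⟩

theorem isScalarSolutionAt_indicator_connectedComponentIn {E : Type*} [NormedAddCommGroup E]
    [NormedSpace ℝ E] (hΩ : IsOpen Ω) {I : Set ℝ} (hI : IsOpen I) {t₀ x₀ : ℝ}
    (hsimple : IsXSimple (connectedComponentIn (Ω ∩ I ×ˢ univ) (t₀, x₀))) {φ : ℝ → ℝ}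
    (hφ : Continuous φ)
    (hφV : tsupport φ ⊆ {t | (t, x₀) ∈ connectedComponentIn (Ω ∩ I ×ˢ univ) (t₀, x₀)})
    (a : C(Ω, ℝ)) (e : E) (z : Ω) :
    IsScalarSolutionAt a ((connectedComponentIn (Ω ∩ I ×ˢ univ) (t₀, x₀)).indicator
      fun w => (φ w.1 * Real.exp (xPrimitive x₀ a w)) • e) z := by
  have hW : IsOpen (Ω ∩ I ×ˢ (univ : Set ℝ)) := hΩ.inter (hI.prod isOpen_univ)
  set V := connectedComponentIn (Ω ∩ I ×ˢ univ) (t₀, x₀)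
  have hVW : V ⊆ Ω ∩ I ×ˢ univ := connectedComponentIn_subset _ _
  obtain ⟨⟨t, x⟩, hz⟩ := z
  by_cases ht : t ∈ tsupport φ
  · by_cases hzV : (t, x) ∈ V
    · have : LocallyCompactSpace Ω := hΩ.locallyCompactSpace
      have hvis : (t, x) ∈ xVisible Ω x₀ := fun s hs =>
        (hVW ((hsimple t).2.uIcc_subset (hφV ht) hzV hs)).1
      refine (isScalarSolutionAt_exp_xPrimitive hΩ a hφ e hvis).congr_of_eventuallyEq ?_
      filter_upwards [hW.connectedComponentIn.mem_nhds hzV] with w hw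
      exact indicator_of_mem hw _
    · refine (isScalarSolutionAt_zero a _).congr_of_eventuallyEq ?_
      filter_upwards [eventually_notMem_connectedComponentIn hW ⟨hz, (hVW (hφV ht)).2⟩ hzV]
        with w hw
      exact indicator_of_notMem hw _
  · refine (isScalarSolutionAt_zero a _).congr_of_eventuallyEq ?_
    filter_upwards [continuous_fst.continuousAt.eventually
      (notMem_tsupport_iff_eventuallyEq.1 ht)] with w hw
    simp [hw]

theorem IsXSimplePiece.exists_isScalarSolutionAt_ne_zero {V : Set (ℝ × ℝ)}
    (hV : IsXSimplePiece Ω V) (hΩ : IsOpen Ω) (E : Type*) [NormedAddCommGroup E] [NormedSpace ℝ E]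
    [Nontrivial E] (a : C(Ω, ℝ)) :
    ∃ v : ℝ × ℝ → E, (∀ z, IsScalarSolutionAt a v z) ∧ ∃ z ∈ Ω, v z ≠ 0 := by
  obtain ⟨I, hI, -, ⟨⟨t₀, x₀⟩, hz₀, rfl⟩, hsimple⟩ := hV
  have hV : IsOpen (connectedComponentIn (Ω ∩ I ×ˢ univ) (t₀, x₀)) :=
    (hΩ.inter (hI.prod isOpen_univ)).connectedComponentIn
  have hz₀V := mem_connectedComponentIn hz₀
  obtain ⟨φ, hφV, -, hφ, -, hφt₀⟩ := exists_contDiff_tsupport_subset (n := 0)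
    ((hV.preimage (Continuous.prodMk_left x₀)).mem_nhds hz₀V)
  obtain ⟨e, he⟩ := exists_ne (0 : E)
  refine ⟨_, isScalarSolutionAt_indicator_connectedComponentIn hΩ hI hsimple hφ.continuous hφV a e,
    (t₀, x₀), hz₀.1, ?_⟩
  rw [indicator_of_mem hz₀V, hφt₀, one_mul]
  exact smul_ne_zero (Real.exp_ne_zero _) he

end XSimplePiece

section ParameterFamily

theorem IsInfiniteParameterFamily.comp {X Y : Type*} [TopologicalSpace X] [TopologicalSpace Y]
    {F : (ℕ → ℝ) → X} (hF : IsInfiniteParameterFamily F) {g : X → Y} (hg : Continuous g)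
    (hginj : Function.Injective g) : IsInfiniteParameterFamily (g ∘ F) :=
  ⟨hg.comp hF.1, hginj.comp hF.2⟩

variable {X : Type*} [TopologicalSpace X]

theorem continuous_tsum_arctan_mul {φ : ℕ → C(X, ℝ)} (hφ : ∀ n x, φ n x ∈ Icc (0 : ℝ) 1) :
    Continuous fun q : (ℕ → ℝ) × X => ∑' n, (1 / 2 : ℝ) ^ n * (Real.arctan (q.1 n) * φ n q.2) := by
  refine continuous_tsum (fun n => by fun_prop) (summable_geometric_two.mul_right (Real.pi / 2))
    fun n q => ?_
  rw [norm_mul, norm_mul, Real.norm_of_nonneg (by positivity), Real.norm_of_nonneg (hφ n _).1]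
  have harctan : ‖Real.arctan (q.1 n)‖ ≤ Real.pi / 2 :=
    abs_le.2 ⟨(Real.neg_pi_div_two_lt_arctan _).le, (Real.arctan_lt_pi_div_two _).le⟩
  gcongr
  exact (mul_le_of_le_one_right (norm_nonneg _) (hφ n _).2).trans harctan

theorem exists_seq_continuousMap_apply_eq_single [T35Space X] {s : Set X} (hs : s.Infinite) :
    ∃ (x : ℕ → X) (φ : ℕ → C(X, ℝ)), (∀ n, x n ∈ s) ∧ (∀ n y, φ n y ∈ Icc (0 : ℝ) 1) ∧
      ∀ n k, φ n (x k) = Pi.single (M := fun _ => ℝ) n 1 k := by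
  have : Infinite s := hs.to_subtype
  obtain ⟨U, hUinf, hU, hdisj⟩ := exists_seq_infinite_isOpen_pairwise_disjoint s
  choose x hx using fun n => (hUinf n).nonempty
  choose O hO hOU using fun n => isOpen_induced_iff.1 (hU n)
  have hxO : ∀ n k, (x k : X) ∈ O n ↔ x k ∈ U n := fun n k => by rw [← hOU n]; rfl
  choose f hf hfx hfO using fun n => CompletelyRegularSpace.completely_regular (x n : X) (O n)ᶜ
    (hO n).isClosed_compl (not_not_intro ((hxO n n).2 (hx n)))
  refine ⟨fun n => x n, fun n => ⟨fun y => 1 - f n y, by fun_prop⟩, fun n => (x n).2,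
    fun n y => ?_, fun n k => ?_⟩
  · exact ⟨sub_nonneg.2 (f n y).2.2, sub_le_self _ (f n y).2.1⟩
  · rcases eq_or_ne k n with rfl | hkn
    · simp [hfx]
    · have hk : (x k : X) ∈ (O n)ᶜ := fun h =>
        disjoint_left.1 (hdisj hkn) (hx k) ((hxO n k).1 h)
      simp [hfO n hk, hkn]

theorem exists_isInfiniteParameterFamily_restrict [T35Space X] {s : Set X} (hs : s.Infinite) :
    ∃ F : (ℕ → ℝ) → C(X, ℝ), IsInfiniteParameterFamily fun c => (F c).restrict s := by
  obtain ⟨x, φ, hxs, hφ, hφx⟩ := exists_seq_continuousMap_apply_eq_single hs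
  have hcont := continuous_tsum_arctan_mul hφ
  let F : (ℕ → ℝ) → C(X, ℝ) := fun c => ⟨_, hcont.comp (Continuous.prodMk_right c)⟩
  have hFx : ∀ c k, F c (x k) = (1 / 2) ^ k * Real.arctan (c k) := fun c k => by
    change ∑' n, (1 / 2 : ℝ) ^ n * (Real.arctan (c n) * φ n (x k)) = _
    rw [tsum_eq_single k fun n hn => by simp [hφx, hn.symm]]
    simp [hφx]
  have hF : Continuous F := ContinuousMap.continuous_of_continuous_uncurry F hcont
  refine ⟨F, (ContinuousMap.continuous_restrict s).comp hF, fun c d hcd => funext fun k => ?_⟩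
  have hk : F c (x k) = F d (x k) := DFunLike.congr_fun hcd ⟨x k, hxs k⟩
  rw [hFx, hFx] at hk
  exact Real.arctan_injective (mul_left_cancel₀ (by positivity) hk)

end ParameterFamily

section ScalarSystem

variable {Ω : Set (ℝ × ℝ)} {p : ℕ}

/-- The system `v_x = a v` of `p` uncoupled copies of one scalar equation. -/
def scalarSystem (p : ℕ) (a : C(Ω, ℝ)) : C(Ω, Matrix (Fin p) (Fin p) ℝ) :=
  (⟨fun x => x • 1, by fun_prop⟩ : C(ℝ, Matrix (Fin p) (Fin p) ℝ)).comp a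

theorem continuous_scalarSystem : Continuous (scalarSystem (Ω := Ω) p) :=
  ContinuousMap.continuous_postcomp _

theorem scalarSystem_injective [NeZero p] : Function.Injective (scalarSystem (Ω := Ω) p) :=
  fun _ _ h => (ContinuousMap.cancel_left (smul_left_injective ℝ one_ne_zero)).1 h

theorem isSystemSolution_scalarSystem_iff (hΩ : IsOpen Ω) {a : C(Ω, ℝ)}
    {v : ℝ × ℝ → Fin p → ℝ} :
    IsSystemSolution Ω (scalarSystem p a) v ↔ ∀ z, IsScalarSolutionAt a v z := by
  have hmul : ∀ z : Ω, (scalarSystem p a z).mulVec (v z) = a z • v z := fun z => by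
    simp [scalarSystem, Matrix.smul_mulVec]
  simp only [IsSystemSolution, hmul]
  refine ⟨fun ⟨⟨hv, hdiff, _⟩, hderiv⟩ z => ?_, fun hv => ⟨⟨?_, ?_, ?_⟩, ?_⟩⟩
  · exact ⟨hv.continuousAt (hΩ.mem_nhds z.2), (hdiff z z.2).hasDerivAt.congr_deriv (hderiv z)⟩
  · exact fun z hz => (hv ⟨z, hz⟩).continuousAt.continuousWithinAt
  · exact fun z hz => (hv ⟨z, hz⟩).hasDerivAt.differentiableAt
  · refine ContinuousOn.congr ((continuousOn_extend_val a).smul fun z hz =>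
      (hv ⟨z, hz⟩).continuousAt.continuousWithinAt) fun z hz => ?_
    rw [Pi.smul_apply', extend_val_apply_of_mem a hz]
    exact (hv ⟨z, hz⟩).hasDerivAt.deriv
  · exact fun z => (hv z).hasDerivAt.deriv

theorem exists_eq_scalarSystem_one (A : C(Ω, Matrix (Fin 1) (Fin 1) ℝ)) :
    ∃ a, A = scalarSystem 1 a := by
  refine ⟨⟨fun z => A z 0 0, by fun_prop⟩, ?_⟩
  ext z i j
  simp [scalarSystem, Subsingleton.elim i 0, Subsingleton.elim j 0]

theorem IsXSimplePiece.not_hasOnlyZeroSolution_scalarSystem {V : Set (ℝ × ℝ)}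
    (hV : IsXSimplePiece Ω V) (hΩ : IsOpen Ω) [NeZero p] (a : C(Ω, ℝ)) :
    ¬ HasOnlyZeroSolution Ω (scalarSystem p a) := by
  obtain ⟨v, hv, z, hz, hvz⟩ := hV.exists_isScalarSolutionAt_ne_zero hΩ (Fin p → ℝ) a
  exact fun h => hvz (h v ((isSystemSolution_scalarSystem_iff hΩ).2 hv) z hz)

theorem eq_zero_of_forall_frequently_lt_xPrimitive {E : Type*} [NormedAddCommGroup E]
    [NormedSpace ℝ E] (hΩ : IsOpen Ω) (hno : ¬ ∃ V, IsXSimplePiece Ω V) {R : Set ℝ}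
    (hR : Dense R) {a : C(Ω, ℝ)} (hunbdd : ∀ r ∈ R, ∀ z ∈ Ω ∩ frontier (xVisible Ω r), ∀ N : ℝ,
      ∃ᶠ w in 𝓝[xVisible Ω r] z, N < xPrimitive r a w)
    {v : ℝ × ℝ → E} (hv : ∀ z, IsScalarSolutionAt a v z) {z : ℝ × ℝ} (hz : z ∈ Ω) : v z = 0 := by
  by_contra hvz
  have hne : ∀ᶠ w in 𝓝 z, w ∈ Ω ∧ v w ≠ 0 :=
    (hΩ.eventually_mem hz).and ((hv ⟨z, hz⟩).continuousAt.eventually_ne hvz)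
  rw [nhds_prod_eq] at hne
  obtain ⟨P, hP, Q, hQ, hPQ⟩ := eventually_prod_iff.1 hne
  obtain ⟨ε, hε, hI⟩ := Metric.eventually_nhds_iff_ball.1 hP
  obtain ⟨r, hr, hQr⟩ := mem_closure_iff_frequently.1 (hR z.2) |>.and_eventually hQ |>.exists
  obtain ⟨z', hz', hz'I⟩ := exists_mem_frontier_xVisible hΩ hno Metric.isOpen_ball
    (convex_ball z.1 ε).ordConnected ⟨z.1, Metric.mem_ball_self hε⟩
    fun t ht => (hPQ (hI t ht) hQr).1
  have hz'r := hPQ (hI _ hz'I) hQr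
  exact hz'r.2 (eq_zero_of_frequently_lt_xPrimitive hΩ hv hz'.1 hz'r.1 (hunbdd r hr z' hz'))

end ScalarSystem

theorem mainTheorem9 (Ω : Set (ℝ × ℝ)) (hΩ : IsOpen Ω) (hne : Ω.Nonempty) :
    (¬ ∃ V : Set (ℝ × ℝ), IsXSimplePiece Ω V) ↔
      ∀ p : ℕ, 1 ≤ p →
        ∃ A : (ℕ → ℝ) → C(Ω, Matrix (Fin p) (Fin p) ℝ),
          IsInfiniteParameterFamily A ∧ ∀ c : ℕ → ℝ, HasOnlyZeroSolution Ω (A c) := by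
  refine ⟨fun hno p hp => ?_, ?_⟩
  · have : NeZero p := ⟨Nat.one_le_iff_ne_zero.1 hp⟩
    obtain ⟨z₀, hz₀⟩ := hne
    obtain ⟨a, ha⟩ := exists_forall_frequently_lt_xPrimitive hΩ (countable_range ((↑) : ℚ → ℝ))
    obtain ⟨F, hF⟩ :=
      exists_isInfiniteParameterFamily_restrict (infinite_of_mem_nhds z₀ (hΩ.mem_nhds hz₀))
    refine ⟨fun c => scalarSystem p (a + (F c).restrict Ω),
      (hF.comp (continuous_const_add a) (add_right_injective a)).comp continuous_scalarSystem
        scalarSystem_injective, fun c v hv z hz => ?_⟩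
    exact eq_zero_of_forall_frequently_lt_xPrimitive hΩ hno Rat.denseRange_cast
      (fun r hr w hw => frequently_lt_xPrimitive_add_restrict (ha r hr w hw) (F c))
      ((isSystemSolution_scalarSystem_iff hΩ).1 hv) hz
  · rintro h ⟨V, hV⟩
    obtain ⟨A, -, hA⟩ := h 1 le_rfl
    obtain ⟨a, ha⟩ := exists_eq_scalarSystem_one (A 0)
    exact hV.not_hasOnlyZeroSolution_scalarSystem hΩ a (ha ▸ hA 0)
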